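/- Let $G$ be a graph with node set $[n]$, let $K_1,\dots,K_m\subseteq[n]$ be a clique cover of $G$ (every $K_j$ is a clique, and every edge and every node of $G$ lies in some $K_j$), let $c\in\mathbb R^n$ and $T>0$. Put $c_{n+j}=0$ and $\bar K_j=K_j\cup\{n+j\}$ for $j\in[m]$ (slack variables), $J_i=\{j\in[m]: i\in\bar K_j\}$ for $i\in[n+m]$, and for $\lambda\in\mathbb R^m$ let $c^\lambda_i=c_i-\sum_{j\in J_i}\lambda_j$ be the reduced costs. With $H(x)=-\sum_{i=1}^{n+m}(x_i\log x_i-x_i)$ (where $0\log 0=0$), define the smoothed dual $$D^T(\lambda)=\sum_{j=1}^m\lambda_j+\max_{x\in[0,1]^{n+m}}\bigl(\langle c^\lambda,x\rangle+T\,H(x)\bigr),\qquad \lambda\in\mathbb R^m .$$ The log-domain Bregman algorithm starts from an arbitrary $\lambda\in\mathbb R^m$ and repeats forever: for $j=1,\dots,m$ in this order (processing the clique $j$), choose $i^*\in\operatorname{argmax}_{i\in\bar K_j}c^\lambda_i$ and set $$\lambda_j:=\lambda_j+c^\lambda_{i^*}+T\log\sum_{i\in\bar K_j}\exp\frac{c^\lambda_i-c^\lambda_{i^*}}{T}.$$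 Then: 1. $D^T$ is convex and differentiable on $\mathbb R^m$. 2. The algorithm is exact coordinate minimization: whenever processing the clique $j$ turns $\lambda$ into $\lambda'$, the vectors $\lambda'$ and $\lambda$ agree outside the coordinate $j$, $\lambda'$ minimizes $D^T$ over all vectors that agree with $\lambda$ outside the coordinate $j$, and $\frac{\partial D^T}{\partial\lambda_j}(\lambda')=0$. 3. The algorithm converges to the optimum of $\min_{\lambda\in\mathbb R^m}D^T(\lambda)$: for every initial vector and every choice of the maximizers $i^*$, there is a minimizer $\lambda^*$ of $D^T$ over $\mathbb R^m$ such that the sequence of all iterates (after each processed clique) converges to $\lambda^*$, and the values of $D^T$ along it converge to $D^T(\lambda^*)=\min D^T$. -/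

import Mathlib

open Filter Topology

noncomputable section

namespace CliqueMWIS

/-- The family `K j`, `j ∈ [m]`, is a clique cover of the graph `G` on the nodes `[n]`: every `K j`
is a clique, and every edge and every node of `G` lies in some `K j`. -/
structure IsCliqueCover {n m : ℕ} (G : SimpleGraph (Fin n)) (K : Fin m → Finset (Fin n)) :
    Prop where
  clique : ∀ j, G.IsClique (K j : Set (Fin n))
  edge : ∀ i i', G.Adj i i' → ∃ j, i ∈ K j ∧ i' ∈ K j
  node : ∀ i, ∃ j, i ∈ K j

/-- The index set of the variables: `Sum.inl i` is the node `i`, `Sum.inr j` is the slack variable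
`n + j` of the clique `j`. -/
abbrev Var (n m : ℕ) : Type := Fin n ⊕ Fin m

/-- The cost vector on all `n + m` variables; slack variables cost `0`. -/
def cost {n m : ℕ} (c : Fin n → ℝ) : Var n m → ℝ := Sum.elim c (fun _ => 0)

/-- The clique `K j` together with its slack variable. -/
def extClique {n m : ℕ} (K : Fin m → Finset (Fin n)) (j : Fin m) : Finset (Var n m) :=
  (K j).disjSum {j}

/-- The constraints that contain the variable `i`. -/
def cliquesOf {n m : ℕ} (K : Fin m → Finset (Fin n)) (i : Var n m) : Finset (Fin m) :=
  Finset.univ.filter (fun j => i ∈ extClique K j)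

/-- The reduced (reparametrized) costs. -/
def reducedCost {n m : ℕ} (K : Fin m → Finset (Fin n)) (c : Fin n → ℝ) (lam : Fin m → ℝ) :
    Var n m → ℝ :=
  fun i => cost c i - ∑ j ∈ cliquesOf K i, lam j

/-- The entropy shifted by a linear function (with `0 log 0 = 0`). -/
def entropy {n m : ℕ} (x : Var n m → ℝ) : ℝ := - ∑ i, (x i * Real.log (x i) - x i)

/-- The objective `⟨v, x⟩ + T H(x)`. -/
def smoothedObjective {n m : ℕ} (T : ℝ) (v x : Var n m → ℝ) : ℝ :=
  ∑ i, v i * x i + T * entropy x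

/-- The maximum of `⟨v, x⟩ + T H(x)` over the box `[0,1]^(n+m)`; it is attained, see
`smoothedMax_isGreatest`. -/
def smoothedMax {n m : ℕ} (T : ℝ) (v : Var n m → ℝ) : ℝ :=
  sSup (smoothedObjective T v '' Set.Icc 0 1)

theorem smoothedMax_isGreatest {n m : ℕ} (T : ℝ) (v : Var n m → ℝ) :
    IsGreatest (smoothedObjective T v '' Set.Icc 0 1) (smoothedMax T v) := by
  have hc : Continuous (smoothedObjective (n := n) (m := m) T v) := by
    unfold smoothedObjective entropy
    have h : ∀ i : Var n m, Continuous fun x : Var n m → ℝ => x i * Real.log (x i) := fun i =>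
      Real.continuous_mul_log.comp (continuous_apply i)
    fun_prop
  exact (isCompact_Icc.image hc).isGreatest_sSup
    ((Set.nonempty_Icc.2 zero_le_one).image _)

/-- The objective of the dual smoothed clique cover relaxation. -/
def smoothedDual {n m : ℕ} (K : Fin m → Finset (Fin n)) (c : Fin n → ℝ) (T : ℝ)
    (lam : Fin m → ℝ) : ℝ :=
  ∑ j, lam j + smoothedMax T (reducedCost K c lam)

/-- Processing the clique `j` may turn `lam` into `lam'`: for some maximizer `i₀` of the reduced
costs in the (extended) clique, `lam j` is increased by
`c_{i₀} + T log ∑_i exp ((c_i - c_{i₀}) / T)`. -/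
def ProcessClique {n m : ℕ} (K : Fin m → Finset (Fin n)) (c : Fin n → ℝ) (T : ℝ) (j : Fin m)
    (lam lam' : Fin m → ℝ) : Prop :=
  ∃ i₀ ∈ extClique K j,
    (∀ i ∈ extClique K j, reducedCost K c lam i ≤ reducedCost K c lam i₀) ∧
    lam' = Function.update lam j
      (lam j + reducedCost K c lam i₀ +
        T * Real.log (∑ i ∈ extClique K j,
          Real.exp ((reducedCost K c lam i - reducedCost K c lam i₀) / T)))

/-- A run (without a stopping criterion) of the log-domain Bregman algorithm: `lam t p` is the dual
vector in the outer iteration `t` after the first `p` cliques have been processed. The initial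
vector `lam 0 0` and the choice of the maximizers are arbitrary. -/
structure IsRun {n m : ℕ} (K : Fin m → Finset (Fin n)) (c : Fin n → ℝ) (T : ℝ)
    (lam : ℕ → Fin (m + 1) → Fin m → ℝ) : Prop where
  inner : ∀ t (j : Fin m), ProcessClique K c T j (lam t j.castSucc) (lam t j.succ)
  outer : ∀ t, lam (t + 1) 0 = lam t (Fin.last m)

end CliqueMWIS

end

/-!
A maximum of affine functions has its maximizer as a subgradient. Here the maximizer over the box,
`x i = min 1 (exp (v i / T))`, is continuous in the reduced costs `v`, so `D^T` is convex and `C¹`,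
and its `j`-th partial derivative is `1 - ∑ x i` over `i ∈ K̄ j`. Processing the clique `j` rescales
`exp (v i / T)` on `K̄ j` to total mass `1`. Then no entry on `K̄ j` exceeds `1`, the truncation is
inactive there, and the partial derivative vanishes.

For the convergence, `D^T` is a poor Lyapunov function: it need be neither coercive nor strictly
convex. The dual `F` of the problem without the constraints `x ≤ 1` serves instead. Processing the
clique `j` also minimizes `F` over its coordinate, lowering it by `T (M - 1 - log M)`, where `M` is
the mass on `K̄ j` before the step. The slack variables make `F` coercive, and a point with all
masses equal to `1` is unique by strict monotonicity of `exp`; such a point minimizes `D^T` too.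
-/

namespace CliqueMWIS

section Subgradient

theorem convexOn_of_subgradient {𝕜 E : Type*} [CommRing 𝕜] [PartialOrder 𝕜] [IsOrderedRing 𝕜]
    [AddCommGroup E] [Module 𝕜 E] {s : Set E} (hs : Convex 𝕜 s) {f : E → 𝕜} {f' : E → E →ₗ[𝕜] 𝕜}
    (h : ∀ x ∈ s, ∀ y ∈ s, f x + f' x (y - x) ≤ f y) : ConvexOn 𝕜 s f := by
  refine ⟨hs, fun x hx y hy a b ha hb hab => ?_⟩
  set z := a • x + b • y with hz
  have hzs : z ∈ s := hs hx hy ha hb hab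
  have hbary : a • (x - z) + b • (y - z) = 0 := by
    rw [smul_sub, smul_sub, sub_add_sub_comm, ← hz, ← add_smul, hab, one_smul, sub_self]
  calc f z = (a + b) * f z + f' z (a • (x - z) + b • (y - z)) := by
        rw [hab, hbary, map_zero, one_mul, add_zero]
    _ = a * (f z + f' z (x - z)) + b * (f z + f' z (y - z)) := by
        simp only [map_add, map_smul, smul_eq_mul]
        ring
    _ ≤ a • f x + b • f y := by
        simp only [smul_eq_mul]
        gcongr
        exacts [h z hzs x hx, h z hzs y hy]

theorem hasFDerivAt_of_subgradient {E : Type*} [NormedAddCommGroup E] [NormedSpace ℝ E]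
    {s : Set E} {f : E → ℝ} {f' : E → E →L[ℝ] ℝ}
    (h : ∀ x ∈ s, ∀ y ∈ s, f x + f' x (y - x) ≤ f y) {x : E} (hs : s ∈ 𝓝 x)
    (hf' : ContinuousAt f' x) : HasFDerivAt f (f' x) x := by
  refine .of_isLittleO (Asymptotics.isLittleO_iff.2 fun ε hε => ?_)
  filter_upwards [hs, Metric.continuousAt_iff'.1 hf' ε hε] with y hy hdist
  have hlower := h x (mem_of_mem_nhds hs) y hy
  have hupper : f y - f x ≤ f' y (y - x) := by
    have := h y hy x (mem_of_mem_nhds hs)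
    rw [← neg_sub y x, map_neg] at this
    linarith
  calc ‖f y - f x - f' x (y - x)‖ ≤ (f' y - f' x) (y - x) := by
        rw [Real.norm_of_nonneg (by linarith), sub_apply]
        linarith
    _ ≤ ‖f' y - f' x‖ * ‖y - x‖ := (le_abs_self _).trans ((f' y - f' x).le_opNorm _)
    _ ≤ ε * ‖y - x‖ := by
        gcongr
        exact (dist_eq_norm (f' y) (f' x) ▸ hdist).le

end Subgradient

section Lyapunov

theorem eq_of_mapClusterPt_of_tendsto {α Y : Type*} [TopologicalSpace Y] [T2Space Y] {l : Filter α}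
    {u : α → Y} {x y : Y} (hx : MapClusterPt x l u) (hy : Tendsto u l (𝓝 y)) : x = y := by
  have : (𝓝 x ⊓ 𝓝 y).NeBot := hx.clusterPt.mono hy
  exact eq_of_nhds_neBot this

variable {X R : Type*} [TopologicalSpace X] [ConditionallyCompleteLinearOrder R]
  [TopologicalSpace R] [OrderTopology R] {f : X → X} {V : X → R} {x₀ : X}

theorem lyapunov_eq_of_mapClusterPt_iterate (hf : Continuous f) (hV : Continuous V)
    (hle : ∀ x, V (f x) ≤ V x) (hbdd : BddBelow (Set.range fun t => V (f^[t] x₀))) {x : X}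
    (hx : MapClusterPt x atTop fun t => f^[t] x₀) : V (f x) = V x := by
  have hanti : Antitone fun t => V (f^[t] x₀) := antitone_nat_of_succ_le fun t => by
    simpa only [Function.iterate_succ_apply'] using hle _
  have hlim := tendsto_atTop_ciInf hanti hbdd
  have hlim_succ := hlim.comp (tendsto_add_atTop_nat 1)
  have hVf : MapClusterPt (V (f x)) atTop fun t => V (f^[t + 1] x₀) := by
    simpa only [Function.comp_def, Function.iterate_succ_apply'] using
      hx.continuousAt_comp (hV.comp hf).continuousAt
  exact (eq_of_mapClusterPt_of_tendsto hVf hlim_succ).trans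
    (eq_of_mapClusterPt_of_tendsto (hx.continuousAt_comp hV.continuousAt) hlim).symm

theorem exists_tendsto_iterate_of_lyapunov (hf : Continuous f) (hV : Continuous V)
    (hle : ∀ x, V (f x) ≤ V x) (hsub : {x | V (f x) = V x}.Subsingleton)
    (hcomp : IsCompact {x | V x ≤ V x₀}) :
    ∃ x, V (f x) = V x ∧ Tendsto (fun t => f^[t] x₀) atTop (𝓝 x) := by
  have hmem : ∀ t, f^[t] x₀ ∈ {x | V x ≤ V x₀} := fun t => by
    induction t with
    | zero => exact le_rfl
    | succ t ih =>
      rw [Function.iterate_succ_apply']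
      exact (hle _).trans ih
  have hbdd : BddBelow (Set.range fun t => V (f^[t] x₀)) := by
    have : Nonempty R := ⟨V x₀⟩
    refine (hcomp.image hV).bddBelow.mono ?_
    rintro _ ⟨t, rfl⟩
    exact Set.mem_image_of_mem V (hmem t)
  have hcluster : ∀ {y}, MapClusterPt y atTop (fun t => f^[t] x₀) → V (f y) = V y :=
    lyapunov_eq_of_mapClusterPt_iterate hf hV hle hbdd
  have hmem_atTop : ∀ᶠ t in atTop, f^[t] x₀ ∈ {x | V x ≤ V x₀} := Eventually.of_forall hmem
  obtain ⟨x, -, hx⟩ := hcomp.exists_mapClusterPt (tendsto_principal.2 hmem_atTop)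
  exact ⟨x, hcluster hx, hcomp.tendsto_nhds_of_unique_mapClusterPt hmem_atTop
    fun y _ hy => hsub (hcluster hy) (hcluster hx)⟩

end Lyapunov

section ScalarInequalities

theorem abs_le_add_mul_exp_neg_div {T : ℝ} (hT : 0 < T) (s : ℝ) :
    |s| ≤ s + T * Real.exp (-s / T) := by
  have hlinear : -(2 * s) ≤ T * Real.exp (-s / T) :=
    calc -(2 * s) = T * (2 * (-s / T)) := by field_simp
      _ ≤ T * Real.exp (-s / T) := by
        gcongr
        exact Real.two_mul_le_exp
  have hpos := mul_pos hT (Real.exp_pos (-s / T))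
  exact abs_le'.2 ⟨by linarith, by linarith⟩

theorem sub_mul_sub_pos_of_strictMono {R : Type*} [Ring R] [LinearOrder R] [IsStrictOrderedRing R]
    {f : R → R} (hf : StrictMono f) {a b : R} (hab : a ≠ b) : 0 < (f b - f a) * (b - a) := by
  rcases hab.lt_or_gt with h | h
  · exact mul_pos (sub_pos.2 (hf h)) (sub_pos.2 h)
  · exact mul_pos_of_neg_of_neg (sub_neg.2 (hf h)) (sub_neg.2 h)

end ScalarInequalities

section BoxMaximum

/-- The contribution of a single variable `x` with reduced cost `v` to `smoothedObjective`. -/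
noncomputable def entropicGain (T v x : ℝ) : ℝ := v * x - T * (x * Real.log x - x)

/-- The maximizer of `entropicGain T v` over `[0, 1]`: the unconstrained maximizer `exp (v / T)`,
truncated at `1`. -/
noncomputable def clippedExp (T v : ℝ) : ℝ := min 1 (Real.exp (v / T))

variable {T : ℝ} {n m : ℕ}

theorem entropicGain_le_mul_exp (hT : 0 < T) (v : ℝ) {x : ℝ} (hx : 0 ≤ x) :
    entropicGain T v x ≤ T * Real.exp (v / T) := by
  rcases hx.eq_or_lt with rfl | hx
  · simpa [entropicGain] using mul_nonneg hT.le (Real.exp_pos _).le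
  · have htangent := Real.add_one_le_exp (v / T - Real.log x)
    rw [Real.exp_sub, Real.exp_log hx, le_div_iff₀ hx] at htangent
    calc entropicGain T v x = T * ((v / T - Real.log x + 1) * x) := by
          rw [entropicGain]
          field_simp
          ring
      _ ≤ T * Real.exp (v / T) := by gcongr

theorem clippedExp_mem_Icc (T v : ℝ) : clippedExp T v ∈ Set.Icc (0 : ℝ) 1 :=
  ⟨le_min zero_le_one (Real.exp_pos _).le, min_le_left _ _⟩

theorem continuous_clippedExp (T : ℝ) : Continuous (clippedExp T) := by
  unfold clippedExp
  fun_prop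

theorem isMaxOn_entropicGain_clippedExp (hT : 0 < T) (v : ℝ) :
    IsMaxOn (entropicGain T v) (Set.Icc 0 1) (clippedExp T v) := by
  rintro x ⟨hx0, hx1⟩
  change entropicGain T v x ≤ entropicGain T v (clippedExp T v)
  rcases le_or_gt v 0 with hv | hv
  · have hclip : clippedExp T v = Real.exp (v / T) :=
      min_eq_right (Real.exp_le_one_iff.2 (div_nonpos_of_nonpos_of_nonneg hv hT.le))
    refine (entropicGain_le_mul_exp hT v hx0).trans_eq ?_
    rw [hclip, entropicGain, Real.log_exp]
    field_simp
    ring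
  · have hclip : clippedExp T v = 1 := min_eq_left (Real.one_le_exp (div_nonneg hv.le hT.le))
    calc entropicGain T v x = v * x + entropicGain T 0 x := by
          simp only [entropicGain]
          ring
      _ ≤ v * 1 + T * Real.exp (0 / T) := by
          gcongr
          exact entropicGain_le_mul_exp hT 0 hx0
      _ = entropicGain T v (clippedExp T v) := by simp [hclip, entropicGain]

theorem smoothedObjective_eq_sum_entropicGain (T : ℝ) (v x : Var n m → ℝ) :
    smoothedObjective T v x = ∑ i, entropicGain T (v i) (x i) := by
  simp only [smoothedObjective, entropy, entropicGain, Finset.sum_sub_distrib, ← Finset.mul_sum]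
  ring

theorem clippedExp_comp_mem_Icc (T : ℝ) (v : Var n m → ℝ) :
    (fun i => clippedExp T (v i)) ∈ Set.Icc (0 : Var n m → ℝ) 1 :=
  ⟨fun i => (clippedExp_mem_Icc T (v i)).1, fun i => (clippedExp_mem_Icc T (v i)).2⟩

theorem smoothedMax_eq_smoothedObjective_clippedExp (hT : 0 < T) (v : Var n m → ℝ) :
    smoothedMax T v = smoothedObjective T v fun i => clippedExp T (v i) := by
  refine (smoothedMax_isGreatest T v).unique
    ⟨Set.mem_image_of_mem _ (clippedExp_comp_mem_Icc T v), ?_⟩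
  rintro _ ⟨x, hx, rfl⟩
  simp only [smoothedObjective_eq_sum_entropicGain]
  exact Finset.sum_le_sum fun i _ => isMaxOn_entropicGain_clippedExp hT (v i) ⟨hx.1 i, hx.2 i⟩

theorem smoothedMax_subgradient (hT : 0 < T) (v w : Var n m → ℝ) :
    smoothedMax T v + ∑ i, clippedExp T (v i) * (w i - v i) ≤ smoothedMax T w := by
  set x : Var n m → ℝ := fun i => clippedExp T (v i)
  calc smoothedMax T v + ∑ i, x i * (w i - v i) = smoothedObjective T w x := by
        rw [smoothedMax_eq_smoothedObjective_clippedExp hT, smoothedObjective, smoothedObjective,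
          add_right_comm, ← Finset.sum_add_distrib]
        congr 2 with i
        ring
    _ ≤ smoothedMax T w :=
        (smoothedMax_isGreatest T w).2 (Set.mem_image_of_mem _ (clippedExp_comp_mem_Icc T v))

end BoxMaximum

variable {n m : ℕ} (K : Fin m → Finset (Fin n)) (c : Fin n → ℝ) {T : ℝ}

section ReducedCost

theorem continuous_reducedCost (i : Var n m) : Continuous fun lam => reducedCost K c lam i := by
  unfold reducedCost
  fun_prop

theorem reducedCost_inr (lam : Fin m → ℝ) (j : Fin m) :
    reducedCost K c lam (Sum.inr j) = -lam j := by
  have : cliquesOf K (Sum.inr j) = {j} := by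
    ext k
    simp [cliquesOf, extClique, eq_comm]
  simp [reducedCost, this, cost]

theorem reducedCost_update (lam : Fin m → ℝ) (j : Fin m) (s : ℝ) (i : Var n m) :
    reducedCost K c (Function.update lam j s) i =
      reducedCost K c lam i - if i ∈ extClique K j then s - lam j else 0 := by
  have hiff : j ∈ cliquesOf K i ↔ i ∈ extClique K j := by simp [cliquesOf]
  split_ifs with hi
  · rw [reducedCost, reducedCost, Finset.sum_update_of_mem (hiff.2 hi),
      Finset.sum_eq_add_sum_sdiff_singleton_of_mem (hiff.2 hi) lam]
    ring
  · rw [reducedCost, reducedCost, Finset.sum_update_of_notMem (mt hiff.1 hi), sub_zero]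

/- The map `lam ↦ reducedCost K c lam` is affine with linear part `-A`, where `A` is the incidence
matrix of variables and cliques; this identity moves `A` to the other side of the pairing. -/
theorem sum_mul_reducedCost_sub (w : Var n m → ℝ) (lam mu : Fin m → ℝ) :
    ∑ i, w i * (reducedCost K c mu i - reducedCost K c lam i) =
      -∑ j, (∑ i ∈ extClique K j, w i) * (mu j - lam j) := by
  have hsub : ∀ i, reducedCost K c mu i - reducedCost K c lam i =
      -∑ j, if i ∈ extClique K j then mu j - lam j else 0 := fun i => by
    rw [← Finset.sum_filter, ← cliquesOf, Finset.sum_sub_distrib, reducedCost, reducedCost]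
    ring
  simp only [hsub, mul_neg, Finset.sum_neg_distrib, Finset.mul_sum, Finset.sum_mul]
  rw [Finset.sum_comm]
  simp only [mul_ite, mul_zero, Finset.sum_ite_mem, Finset.univ_inter]

end ReducedCost

section SmoothedDual

/-- The `j`-th partial derivative of `smoothedDual K c T` at `lam`. -/
noncomputable def smoothedDualPartial (T : ℝ) (lam : Fin m → ℝ) (j : Fin m) : ℝ :=
  1 - ∑ i ∈ extClique K j, clippedExp T (reducedCost K c lam i)

/-- The derivative of `smoothedDual K c T` at `lam`, as a linear functional. -/
noncomputable def smoothedDualDeriv (T : ℝ) (lam : Fin m → ℝ) : (Fin m → ℝ) →L[ℝ] ℝ :=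
  ∑ j, smoothedDualPartial K c T lam j • ContinuousLinearMap.proj j

theorem smoothedDualDeriv_apply (T : ℝ) (lam d : Fin m → ℝ) :
    smoothedDualDeriv K c T lam d = ∑ j, smoothedDualPartial K c T lam j * d j := by
  simp [smoothedDualDeriv]

theorem continuous_smoothedDualDeriv (T : ℝ) : Continuous (smoothedDualDeriv K c T) := by
  have hpartial : ∀ j, Continuous fun lam => smoothedDualPartial K c T lam j := fun j =>
    continuous_const.sub (continuous_finsetSum _ fun i _ =>
      (continuous_clippedExp T).comp (continuous_reducedCost K c i))
  exact continuous_finsetSum _ fun j _ => (hpartial j).smul continuous_const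

theorem smoothedDual_subgradient (hT : 0 < T) (lam mu : Fin m → ℝ) :
    smoothedDual K c T lam + smoothedDualDeriv K c T lam (mu - lam) ≤ smoothedDual K c T mu := by
  have hmax := smoothedMax_subgradient hT (reducedCost K c lam) (reducedCost K c mu)
  rw [sum_mul_reducedCost_sub] at hmax
  simp only [smoothedDual, smoothedDualDeriv_apply, smoothedDualPartial, Pi.sub_apply, sub_mul,
    one_mul, Finset.sum_sub_distrib] at hmax ⊢
  linarith

theorem convexOn_smoothedDual (hT : 0 < T) : ConvexOn ℝ Set.univ (smoothedDual K c T) :=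
  convexOn_of_subgradient convex_univ (f' := fun lam => (smoothedDualDeriv K c T lam).toLinearMap)
    fun lam _ mu _ => smoothedDual_subgradient K c hT lam mu

theorem hasFDerivAt_smoothedDual (hT : 0 < T) (lam : Fin m → ℝ) :
    HasFDerivAt (smoothedDual K c T) (smoothedDualDeriv K c T lam) lam :=
  hasFDerivAt_of_subgradient (fun lam _ mu _ => smoothedDual_subgradient K c hT lam mu)
    univ_mem (continuous_smoothedDualDeriv K c T).continuousAt

theorem differentiable_smoothedDual (hT : 0 < T) : Differentiable ℝ (smoothedDual K c T) :=
  fun lam => (hasFDerivAt_smoothedDual K c hT lam).differentiableAt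

theorem hasDerivAt_smoothedDual_update (hT : 0 < T) (lam : Fin m → ℝ) (j : Fin m) :
    HasDerivAt (fun s => smoothedDual K c T (Function.update lam j s))
      (smoothedDualPartial K c T lam j) (lam j) := by
  have h := (hasFDerivAt_smoothedDual K c hT lam).comp_hasDerivAt_of_eq (lam j)
    (hasDerivAt_update lam j (lam j)) (Function.update_eq_self j lam).symm
  simpa [smoothedDualDeriv_apply, Pi.single_apply, Function.comp_def] using h

theorem smoothedDual_le_of_partial_eq_zero (hT : 0 < T) {lam mu : Fin m → ℝ}
    (h : ∀ j, mu j ≠ lam j → smoothedDualPartial K c T lam j = 0) :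
    smoothedDual K c T lam ≤ smoothedDual K c T mu := by
  have hzero : smoothedDualDeriv K c T lam (mu - lam) = 0 := by
    rw [smoothedDualDeriv_apply]
    refine Finset.sum_eq_zero fun j _ => mul_eq_zero.2 ?_
    rcases eq_or_ne (mu j) (lam j) with hj | hj
    · exact .inr (sub_eq_zero.2 hj)
    · exact .inl (h j hj)
  simpa [hzero] using smoothedDual_subgradient K c hT lam mu

end SmoothedDual

section CliqueStep

/-- The total mass that the untruncated primal point `exp (c^lam / T)` puts on the extended
clique `j`. -/
noncomputable def cliqueMass (T : ℝ) (j : Fin m) (lam : Fin m → ℝ) : ℝ :=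
  ∑ i ∈ extClique K j, Real.exp (reducedCost K c lam i / T)

/-- The result of processing the clique `j`, which does not depend on the choice of a maximizer. -/
noncomputable def cliqueStep (T : ℝ) (j : Fin m) (lam : Fin m → ℝ) : Fin m → ℝ :=
  Function.update lam j (lam j + T * Real.log (cliqueMass K c T j lam))

theorem cliqueMass_pos (T : ℝ) (j : Fin m) (lam : Fin m → ℝ) : 0 < cliqueMass K c T j lam :=
  Finset.sum_pos (fun _ _ => Real.exp_pos _) ⟨Sum.inr j, by simp [extClique]⟩

theorem continuous_cliqueStep (T : ℝ) (j : Fin m) : Continuous (cliqueStep K c T j) := by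
  have h : Continuous (cliqueMass K c T j) := continuous_finsetSum _ fun i _ =>
    Real.continuous_exp.comp ((continuous_reducedCost K c i).div_const T)
  exact continuous_id.update j ((continuous_apply j).add
    (continuous_const.mul (h.log fun lam => (cliqueMass_pos K c T j lam).ne')))

variable {K c} in
theorem cliqueStep_eq_self {j : Fin m} {lam : Fin m → ℝ} (h : cliqueMass K c T j lam = 1) :
    cliqueStep K c T j lam = lam := by
  simp [cliqueStep, h]

variable {K c} in
theorem smoothedDualPartial_eq_zero_of_cliqueMass_eq_one {j : Fin m} {lam : Fin m → ℝ}
    (h : cliqueMass K c T j lam = 1) : smoothedDualPartial K c T lam j = 0 := by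
  have hclip : ∀ i ∈ extClique K j,
      clippedExp T (reducedCost K c lam i) = Real.exp (reducedCost K c lam i / T) := fun i hi => by
    refine min_eq_right (le_of_le_of_eq ?_ h)
    exact Finset.single_le_sum (f := fun i => Real.exp (reducedCost K c lam i / T))
      (fun _ _ => (Real.exp_pos _).le) hi
  rw [smoothedDualPartial, Finset.sum_congr rfl hclip, ← cliqueMass, h, sub_self]

variable {K c} in
theorem ProcessClique.eq_cliqueStep (hT : T ≠ 0) {j : Fin m} {lam lam' : Fin m → ℝ}
    (h : ProcessClique K c T j lam lam') : lam' = cliqueStep K c T j lam := by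
  obtain ⟨i₀, -, -, rfl⟩ := h
  have hfactor : ∑ i ∈ extClique K j,
      Real.exp ((reducedCost K c lam i - reducedCost K c lam i₀) / T) =
      cliqueMass K c T j lam / Real.exp (reducedCost K c lam i₀ / T) := by
    simp only [cliqueMass, Finset.sum_div, sub_div, Real.exp_sub]
  rw [cliqueStep, hfactor, Real.log_div (cliqueMass_pos K c T j lam).ne' (Real.exp_pos _).ne',
    Real.log_exp, mul_sub, mul_div_cancel₀ _ hT, add_assoc, add_sub_cancel]

theorem exp_reducedCost_cliqueStep (hT : T ≠ 0) (j : Fin m) (lam : Fin m → ℝ) (i : Var n m) :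
    Real.exp (reducedCost K c (cliqueStep K c T j lam) i / T) =
      if i ∈ extClique K j then Real.exp (reducedCost K c lam i / T) / cliqueMass K c T j lam
      else Real.exp (reducedCost K c lam i / T) := by
  rw [cliqueStep, reducedCost_update]
  split_ifs with hi
  · rw [add_sub_cancel_left, sub_div, mul_div_cancel_left₀ _ hT, Real.exp_sub,
      Real.exp_log (cliqueMass_pos K c T j lam)]
  · rw [sub_zero]

theorem cliqueMass_cliqueStep (hT : T ≠ 0) (j : Fin m) (lam : Fin m → ℝ) :
    cliqueMass K c T j (cliqueStep K c T j lam) = 1 := by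
  rw [cliqueMass, Finset.sum_congr rfl fun i hi =>
    (exp_reducedCost_cliqueStep K c hT j lam i).trans (if_pos hi), ← Finset.sum_div]
  exact div_self (cliqueMass_pos K c T j lam).ne'

end CliqueStep

section ExpDual

/-- The dual of the entropy-smoothed problem without the upper bounds `x ≤ 1`; it is the Lyapunov
function of the algorithm. -/
noncomputable def expDual (T : ℝ) (lam : Fin m → ℝ) : ℝ :=
  ∑ j, lam j + T * ∑ i, Real.exp (reducedCost K c lam i / T)

theorem continuous_expDual (T : ℝ) : Continuous (expDual K c T) := by
  have h : Continuous fun lam => ∑ i, Real.exp (reducedCost K c lam i / T) :=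
    continuous_finsetSum _ fun i _ =>
      Real.continuous_exp.comp ((continuous_reducedCost K c i).div_const T)
  unfold expDual
  fun_prop

theorem expDual_cliqueStep (hT : T ≠ 0) (j : Fin m) (lam : Fin m → ℝ) :
    expDual K c T (cliqueStep K c T j lam) = expDual K c T lam -
      T * (cliqueMass K c T j lam - 1 - Real.log (cliqueMass K c T j lam)) := by
  have hlam : ∑ k, cliqueStep K c T j lam k =
      ∑ k, lam k + T * Real.log (cliqueMass K c T j lam) := by
    rw [cliqueStep, Finset.sum_update_of_mem (Finset.mem_univ j),
      Finset.sum_eq_add_sum_sdiff_singleton_of_mem (Finset.mem_univ j) lam]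
    ring
  have hsplit : ∀ mu, ∑ i, Real.exp (reducedCost K c mu i / T) = cliqueMass K c T j mu +
      ∑ i ∈ (extClique K j)ᶜ, Real.exp (reducedCost K c mu i / T) := fun mu =>
    (Finset.sum_add_sum_compl _ _).symm
  have hcompl :
      ∑ i ∈ (extClique K j)ᶜ, Real.exp (reducedCost K c (cliqueStep K c T j lam) i / T) =
        ∑ i ∈ (extClique K j)ᶜ, Real.exp (reducedCost K c lam i / T) :=
    Finset.sum_congr rfl fun i hi =>
      (exp_reducedCost_cliqueStep K c hT j lam i).trans (if_neg (Finset.mem_compl.1 hi))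
  rw [expDual, expDual, hlam, hsplit, hsplit, hcompl, cliqueMass_cliqueStep K c hT]
  ring

theorem expDual_cliqueStep_le (hT : 0 < T) (j : Fin m) (lam : Fin m → ℝ) :
    expDual K c T (cliqueStep K c T j lam) ≤ expDual K c T lam := by
  rw [expDual_cliqueStep K c hT.ne']
  have hlog := Real.log_le_sub_one_of_pos (cliqueMass_pos K c T j lam)
  exact sub_le_self _ (mul_nonneg hT.le (sub_nonneg.2 hlog))

variable {K c} in
theorem cliqueMass_eq_one_of_expDual_cliqueStep_eq (hT : T ≠ 0) {j : Fin m} {lam : Fin m → ℝ}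
    (h : expDual K c T (cliqueStep K c T j lam) = expDual K c T lam) :
    cliqueMass K c T j lam = 1 := by
  by_contra hne
  rw [expDual_cliqueStep K c hT, sub_eq_self] at h
  have hlog := Real.log_lt_sub_one_of_pos (cliqueMass_pos K c T j lam) hne
  exact mul_ne_zero hT (sub_pos.2 hlog).ne' h

theorem abs_le_expDual (hT : 0 < T) (lam : Fin m → ℝ) (j : Fin m) :
    |lam j| ≤ expDual K c T lam := by
  have hnodes : 0 ≤ T * ∑ i : Fin n, Real.exp (reducedCost K c lam (Sum.inl i) / T) := by
    positivity
  calc |lam j| ≤ ∑ k, |lam k| :=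
        Finset.single_le_sum (f := fun k => |lam k|) (fun _ _ => abs_nonneg _) (Finset.mem_univ j)
    _ ≤ ∑ k, (lam k + T * Real.exp (-lam k / T)) :=
        Finset.sum_le_sum fun k _ => abs_le_add_mul_exp_neg_div hT (lam k)
    _ ≤ expDual K c T lam := by
        rw [expDual, Fintype.sum_sum_type, Finset.sum_add_distrib, ← Finset.mul_sum]
        simp only [reducedCost_inr]
        linarith

theorem isCompact_expDual_le (hT : 0 < T) (C : ℝ) : IsCompact {lam | expDual K c T lam ≤ C} := by
  refine (isCompact_Icc (a := fun _ => -C) (b := fun _ => C)).of_isClosed_subset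
    (isClosed_le (continuous_expDual K c T) continuous_const) fun lam hlam => ?_
  have hbound : ∀ j, |lam j| ≤ C := fun j => (abs_le_expDual K c hT lam j).trans hlam
  exact ⟨fun j => (abs_le.1 (hbound j)).1, fun j => (abs_le.1 (hbound j)).2⟩

variable {K c} in
theorem eq_of_cliqueMass_eq (hT : 0 < T) {lam mu : Fin m → ℝ}
    (h : ∀ j, cliqueMass K c T j lam = cliqueMass K c T j mu) : lam = mu := by
  by_contra hne
  obtain ⟨j, hj⟩ := Function.ne_iff.1 hne
  set a := reducedCost K c lam
  set b := reducedCost K c mu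
  have hpos : ∀ i, a i ≠ b i →
      0 < (Real.exp (b i / T) - Real.exp (a i / T)) * (b i - a i) := fun i =>
    sub_mul_sub_pos_of_strictMono (f := fun s => Real.exp (s / T))
      (Real.exp_strictMono.comp fun _ _ hst => div_lt_div_of_pos_right hst hT)
  have hslack : a (Sum.inr j) ≠ b (Sum.inr j) := by
    simpa only [a, b, reducedCost_inr, ne_eq, neg_inj] using hj
  have hsum_pos : 0 < ∑ i, (Real.exp (b i / T) - Real.exp (a i / T)) * (b i - a i) := by
    refine Finset.sum_pos' (fun i _ => ?_) ⟨Sum.inr j, Finset.mem_univ _, hpos _ hslack⟩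
    by_cases hi : a i = b i
    · simp [hi]
    · exact (hpos i hi).le
  refine hsum_pos.ne' ?_
  rw [sum_mul_reducedCost_sub, neg_eq_zero]
  refine Finset.sum_eq_zero fun k _ => ?_
  rw [Finset.sum_sub_distrib, ← cliqueMass, ← cliqueMass, h k, sub_self, zero_mul]

end ExpDual

section Sweep

/-- The result of processing the first `p` cliques in order. -/
noncomputable def partialSweep (T : ℝ) (p : Fin (m + 1)) : (Fin m → ℝ) → Fin m → ℝ :=
  Fin.induction (motive := fun _ => (Fin m → ℝ) → Fin m → ℝ) id
    (fun j f => cliqueStep K c T j ∘ f) p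

theorem partialSweep_succ (T : ℝ) (j : Fin m) (lam : Fin m → ℝ) :
    partialSweep K c T j.succ lam = cliqueStep K c T j (partialSweep K c T j.castSucc lam) := rfl

theorem continuous_partialSweep (T : ℝ) (p : Fin (m + 1)) :
    Continuous (partialSweep K c T p) := by
  induction p using Fin.induction with
  | zero => exact continuous_id
  | succ j ih => exact (continuous_cliqueStep K c T j).comp ih

theorem antitone_expDual_partialSweep (hT : 0 < T) (lam : Fin m → ℝ) :
    Antitone fun p => expDual K c T (partialSweep K c T p lam) :=
  Fin.antitone_iff_succ_le.2 fun j => by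
    simpa only [partialSweep_succ] using expDual_cliqueStep_le K c hT j _

variable {K c}

theorem partialSweep_eq_self {lam : Fin m → ℝ} (h : ∀ j, cliqueMass K c T j lam = 1)
    (p : Fin (m + 1)) : partialSweep K c T p lam = lam := by
  induction p using Fin.induction with
  | zero => rfl
  | succ j ih => rw [partialSweep_succ, ih, cliqueStep_eq_self (h j)]

theorem cliqueMass_eq_one_of_expDual_sweep_eq (hT : 0 < T) {lam : Fin m → ℝ}
    (h : expDual K c T (partialSweep K c T (Fin.last m) lam) = expDual K c T lam) (j : Fin m) :
    cliqueMass K c T j lam = 1 := by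
  have hconst : ∀ p, expDual K c T (partialSweep K c T p lam) = expDual K c T lam := fun p =>
    le_antisymm (antitone_expDual_partialSweep K c hT lam (Fin.zero_le p))
      (h.symm.trans_le (antitone_expDual_partialSweep K c hT lam (Fin.le_last p)))
  have hmass : ∀ k : Fin m, cliqueMass K c T k (partialSweep K c T k.castSucc lam) = 1 :=
    fun k => cliqueMass_eq_one_of_expDual_cliqueStep_eq hT.ne' <| by
      rw [← partialSweep_succ, hconst, hconst]
  have hfix : ∀ p, partialSweep K c T p lam = lam := fun p => by
    induction p using Fin.induction with
    | zero => rfl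
    | succ k ih => rw [partialSweep_succ, cliqueStep_eq_self (hmass k), ih]
  simpa only [hfix] using hmass j

theorem exists_tendsto_iterate_sweep (hT : 0 < T) (lam₀ : Fin m → ℝ) :
    ∃ lamOpt, (∀ j, cliqueMass K c T j lamOpt = 1) ∧
      Tendsto (fun t => (partialSweep K c T (Fin.last m))^[t] lam₀) atTop (𝓝 lamOpt) := by
  have hunique : {lam | expDual K c T (partialSweep K c T (Fin.last m) lam) =
      expDual K c T lam}.Subsingleton := fun lam hlam mu hmu =>
    eq_of_cliqueMass_eq hT fun j => by
      rw [cliqueMass_eq_one_of_expDual_sweep_eq hT hlam,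
        cliqueMass_eq_one_of_expDual_sweep_eq hT hmu]
  obtain ⟨lamOpt, heq, hlim⟩ := exists_tendsto_iterate_of_lyapunov
    (continuous_partialSweep K c T (Fin.last m)) (continuous_expDual K c T)
    (fun lam => antitone_expDual_partialSweep K c hT lam (Fin.zero_le _)) hunique
    (isCompact_expDual_le K c hT (expDual K c T lam₀))
  exact ⟨lamOpt, cliqueMass_eq_one_of_expDual_sweep_eq hT heq, hlim⟩

variable {lam : ℕ → Fin (m + 1) → Fin m → ℝ}

theorem IsRun.eq_partialSweep (h : IsRun K c T lam) (hT : T ≠ 0) (t : ℕ) (p : Fin (m + 1)) :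
    lam t p = partialSweep K c T p (lam t 0) := by
  induction p using Fin.induction with
  | zero => rfl
  | succ j ih => rw [partialSweep_succ, ← ih, (h.inner t j).eq_cliqueStep hT]

theorem IsRun.eq_iterate (h : IsRun K c T lam) (hT : T ≠ 0) (t : ℕ) :
    lam t 0 = (partialSweep K c T (Fin.last m))^[t] (lam 0 0) := by
  induction t with
  | zero => rfl
  | succ t ih => rw [h.outer, h.eq_partialSweep hT, ih, Function.iterate_succ_apply']

theorem IsRun.exists_tendsto (h : IsRun K c T lam) (hT : 0 < T) :
    ∃ lamOpt, (∀ j, cliqueMass K c T j lamOpt = 1) ∧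
      ∀ p, Tendsto (fun t => lam t p) atTop (𝓝 lamOpt) := by
  obtain ⟨lamOpt, hmass, hlim⟩ := exists_tendsto_iterate_sweep (K := K) (c := c) hT (lam 0 0)
  refine ⟨lamOpt, hmass, fun p => ?_⟩
  have hsweep := ((continuous_partialSweep K c T p).tendsto lamOpt).comp hlim
  rw [partialSweep_eq_self hmass] at hsweep
  exact hsweep.congr fun t => by
    rw [Function.comp_apply, ← h.eq_iterate hT.ne', ← h.eq_partialSweep hT.ne']

end Sweep

section ExactMinimization

variable {K c} {j : Fin m} {lam lam' : Fin m → ℝ}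

theorem ProcessClique.eq_of_ne (h : ProcessClique K c T j lam lam') {k : Fin m} (hk : k ≠ j) :
    lam' k = lam k := by
  obtain ⟨-, -, -, rfl⟩ := h
  exact Function.update_of_ne hk _ _

theorem ProcessClique.smoothedDualPartial_eq_zero (h : ProcessClique K c T j lam lam')
    (hT : T ≠ 0) : smoothedDualPartial K c T lam' j = 0 := by
  rw [h.eq_cliqueStep hT]
  exact smoothedDualPartial_eq_zero_of_cliqueMass_eq_one (cliqueMass_cliqueStep K c hT j lam)

theorem ProcessClique.smoothedDual_le_update (h : ProcessClique K c T j lam lam') (hT : 0 < T)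
    (s : ℝ) : smoothedDual K c T lam' ≤ smoothedDual K c T (Function.update lam j s) := by
  refine smoothedDual_le_of_partial_eq_zero K c hT fun k hk => ?_
  obtain rfl : k = j := by
    by_contra hkj
    exact hk (by rw [Function.update_of_ne hkj, h.eq_of_ne hkj])
  exact h.smoothedDualPartial_eq_zero hT.ne'

end ExactMinimization

end CliqueMWIS

theorem mainTheorem4_general {n m : ℕ} (K : Fin m → Finset (Fin n)) (c : Fin n → ℝ) (T : ℝ)
    (hT : 0 < T) :
    ConvexOn ℝ Set.univ (CliqueMWIS.smoothedDual K c T) ∧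
    Differentiable ℝ (CliqueMWIS.smoothedDual K c T) ∧
    (∀ (j : Fin m) (lam lam' : Fin m → ℝ), CliqueMWIS.ProcessClique K c T j lam lam' →
      HasDerivAt (fun s : ℝ => CliqueMWIS.smoothedDual K c T (Function.update lam' j s))
        0 (lam' j) ∧
      (∀ k, k ≠ j → lam' k = lam k) ∧
      ∀ s : ℝ, CliqueMWIS.smoothedDual K c T lam' ≤
        CliqueMWIS.smoothedDual K c T (Function.update lam j s)) ∧
    (∀ lam : ℕ → Fin (m + 1) → Fin m → ℝ, CliqueMWIS.IsRun K c T lam →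
      ∃ lamOpt : Fin m → ℝ,
        (∀ mu : Fin m → ℝ,
          CliqueMWIS.smoothedDual K c T lamOpt ≤ CliqueMWIS.smoothedDual K c T mu) ∧
        ∀ p : Fin (m + 1),
          Tendsto (fun t => lam t p) atTop (𝓝 lamOpt) ∧
          Tendsto (fun t => CliqueMWIS.smoothedDual K c T (lam t p)) atTop
            (𝓝 (CliqueMWIS.smoothedDual K c T lamOpt))) := by
  have hdiff := CliqueMWIS.differentiable_smoothedDual K c hT
  refine ⟨CliqueMWIS.convexOn_smoothedDual K c hT, hdiff, fun j lam lam' hstep => ⟨?_, ?_, ?_⟩,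
    fun lam hrun => ?_⟩
  · rw [← hstep.smoothedDualPartial_eq_zero hT.ne']
    exact CliqueMWIS.hasDerivAt_smoothedDual_update K c hT lam' j
  · exact fun k hk => hstep.eq_of_ne hk
  · exact hstep.smoothedDual_le_update hT
  · obtain ⟨lamOpt, hmass, hlim⟩ := hrun.exists_tendsto hT
    have hopt : ∀ mu, CliqueMWIS.smoothedDual K c T lamOpt ≤ CliqueMWIS.smoothedDual K c T mu :=
      fun mu => CliqueMWIS.smoothedDual_le_of_partial_eq_zero K c hT fun j _ =>
        CliqueMWIS.smoothedDualPartial_eq_zero_of_cliqueMass_eq_one (hmass j)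
    exact ⟨lamOpt, hopt, fun p => ⟨hlim p, (hdiff.continuous.tendsto lamOpt).comp (hlim p)⟩⟩

theorem mainTheorem4 {n m : ℕ} (G : SimpleGraph (Fin n)) (K : Fin m → Finset (Fin n))
    (hK : CliqueMWIS.IsCliqueCover G K) (c : Fin n → ℝ) (T : ℝ) (hT : 0 < T) :
    -- the smoothed dual is convex and differentiable
    ConvexOn ℝ Set.univ (CliqueMWIS.smoothedDual K c T) ∧
    Differentiable ℝ (CliqueMWIS.smoothedDual K c T) ∧
    -- processing a clique is an exact minimization over its coordinate
    (∀ (j : Fin m) (lam lam' : Fin m → ℝ), CliqueMWIS.ProcessClique K c T j lam lam' →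
      HasDerivAt (fun s : ℝ => CliqueMWIS.smoothedDual K c T (Function.update lam' j s))
        0 (lam' j) ∧
      (∀ k, k ≠ j → lam' k = lam k) ∧
      ∀ s : ℝ, CliqueMWIS.smoothedDual K c T lam' ≤
        CliqueMWIS.smoothedDual K c T (Function.update lam j s)) ∧
    -- all iterates converge to a minimizer, and their values to the minimum
    (∀ lam : ℕ → Fin (m + 1) → Fin m → ℝ, CliqueMWIS.IsRun K c T lam →
      ∃ lamOpt : Fin m → ℝ,
        (∀ mu : Fin m → ℝ,
          CliqueMWIS.smoothedDual K c T lamOpt ≤ CliqueMWIS.smoothedDual K c T mu) ∧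
        ∀ p : Fin (m + 1),
          Tendsto (fun t => lam t p) atTop (𝓝 lamOpt) ∧
          Tendsto (fun t => CliqueMWIS.smoothedDual K c T (lam t p)) atTop
            (𝓝 (CliqueMWIS.smoothedDual K c T lamOpt))) :=
  mainTheorem4_general K c T hT
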